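/- Let $a<b$, let $\omega\in\mathbb R$, let $p\ge 1$, and let $a=x_0<x_1<\dots<x_n=b$ be a subdivision of $[a,b]$ into $n\ge 1$ cells (for instance a member of a quasi-uniform family), with mesh size $h=\min_{1\le j\le n}(x_j-x_{j-1})$. Let $W_k(x)=\dfrac{(1-x^2)\,C_k^{(3/2)}(x)}{(k+1)(k+2)}$ be the integrated Legendre functions, where $C_k^{(3/2)}$ is the ultraspherical polynomial. Let $W_{kj}$ ($1\le j\le n$) be $W_k$ mapped affinely from $[-1,1]$ to $[x_{j-1},x_j]$ and extended by zero, and let $h_0,\dots,h_n$ be the standard piecewise linear hat functions of the subdivision. Let $$\mathbf C_{0:p}=\{h_0,\dots,h_n\}\cup\{W_{kj}:0\le k\le p-2,\ 1\le j\le n\}\quad\text{(Neumann case)},$$ $$\mathbf Q_{0:p}=\{h_1,\dots,h_{n-1}\}\cup\{W_{kj}:0\le k\le p-2,\ 1\le j\le n\}\quad\text{(Dirichlet case)}.$$ For $\mathbf Y\in\{\mathbf C,\mathbf Q\}$, with $\mathbf Y_{0:p}=(y_i)_i$, define $$(M_{Y,p})_{ij}=\int_a^b y_i y_j\,dx,\qquad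 (-\Delta_{Y,p})_{ij}=\int_a^b y_i' y_j'\,dx .$$ In the Neumann case $\mathbf Y=\mathbf C$ assume $\omega\neq 0$. Let $L$ be a real square matrix with $$L^\top L=-\Delta_{Y,p}+\tfrac{\omega^2}{2}M_{Y,p}.$$ Then $L$ is invertible, and the spectrum of $L^{-\top}M_{Y,p}L^{-1}$ (as a complex matrix) is real and satisfies $$\sigma\big(L^{-\top}M_{Y,p}L^{-1}\big)\subseteq\left[\frac{2h^2}{24p^4+\omega^2h^2},\;C\right],$$ where $C=\min\big((b-a)^2/\pi^2,\ \max(1,2/\omega^2)\big)$ in the Dirichlet case (with $2/\omega^2=+\infty$ if $\omega=0$, so that then $C=(b-a)^2/\pi^2$) and $C=\max(1,2/\omega^2)$ in the Neumann case. -/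

import Mathlib

namespace HpFEM

noncomputable section

/-- The ultraspherical (Gegenbauer) polynomials `C_k^{(lam)}`, generated by their standard
three-term recurrence
`(k+2) C_{k+2} = 2 (k+1+lam) x C_{k+1} - (k + 2 lam) C_k`, `C_0 = 1`, `C_1 = 2 lam x`.
They are orthogonal on `[-1,1]` with respect to `(1 - x^2)^(lam - 1/2)` and have leading
coefficient `2^k (lam)_k / k!`. -/
def ultraspherical (lam : ℝ) : ℕ → Polynomial ℝ
  | 0 => 1
  | 1 => Polynomial.C (2 * lam) * Polynomial.X
  | k + 2 =>
      Polynomial.C (1 / ((k : ℝ) + 2)) *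
        (Polynomial.C (2 * ((k : ℝ) + 1 + lam)) * Polynomial.X * ultraspherical lam (k + 1)
          - Polynomial.C ((k : ℝ) + 2 * lam) * ultraspherical lam k)

/-- The integrated Legendre functions
`W_k(x) = (1 - x^2) C_k^{(3/2)}(x) / ((k+1)(k+2))` on the reference interval `[-1,1]`. -/
def W (k : ℕ) (t : ℝ) : ℝ :=
  (1 - t ^ 2) * (ultraspherical (3 / 2) k).eval t / (((k : ℝ) + 1) * ((k : ℝ) + 2))

/-- `x 0, …, x n` are the nodes of a subdivision `a = x 0 < x 1 < ⋯ < x n = b` of `[a,b]` into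
`n` cells. The values `x j` with `j > n` play no role. -/
structure IsSubdivision (a b : ℝ) (n : ℕ) (x : ℕ → ℝ) : Prop where
  left : x 0 = a
  right : x n = b
  lt_succ : ∀ j < n, x j < x (j + 1)

/-- The mesh size: the minimum of the diameters of the cells `[x j, x (j+1)]`, `j < n`. -/
def meshSize (n : ℕ) (x : ℕ → ℝ) : ℝ :=
  ⨅ j : Fin n, (x (j + 1) - x j)

/-- The bubble function `W_k` mapped affinely to the cell `[x j, x (j+1)]` (cells are numbered
`j = 0, …, n-1`), extended by zero. -/
def bubble (x : ℕ → ℝ) (k j : ℕ) (t : ℝ) : ℝ :=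
  if x j ≤ t ∧ t ≤ x (j + 1) then
    W k ((2 * t - x j - x (j + 1)) / (x (j + 1) - x j))
  else 0

/-- The piecewise linear hat function `h_j`, `j = 0, …, n`. The first branch is absent for
`j = 0`, the second one is absent for `j = n`. -/
def hat (n : ℕ) (x : ℕ → ℝ) (j : ℕ) (t : ℝ) : ℝ :=
  if 1 ≤ j ∧ x (j - 1) ≤ t ∧ t ≤ x j then (t - x (j - 1)) / (x j - x (j - 1))
  else if j < n ∧ x j ≤ t ∧ t ≤ x (j + 1) then (x (j + 1) - t) / (x (j + 1) - x j)
  else 0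

/-- The basis `C_{0:p} = [h_0, …, h_n | W_0 | ⋯ | W_{p-2}]` (Neumann boundary condition), where
the block `W_k` consists of the bubble functions of index `k` on the `n` cells. -/
def basisC (n p : ℕ) (x : ℕ → ℝ) : Fin (n + 1) ⊕ (Fin (p - 1) × Fin n) → ℝ → ℝ
  | Sum.inl j => hat n x j
  | Sum.inr (k, j) => bubble x k j

/-- The basis `Q_{0:p} = [h_1, …, h_{n-1} | W_0 | ⋯ | W_{p-2}]` (Dirichlet boundary condition). -/
def basisQ (n p : ℕ) (x : ℕ → ℝ) : Fin (n - 1) ⊕ (Fin (p - 1) × Fin n) → ℝ → ℝ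
  | Sum.inl j => hat n x (j + 1)
  | Sum.inr (k, j) => bubble x k j

/-- The mass matrix `M_Y = ⟨Yᵀ, Y⟩` in `L²(a,b)`. -/
def massMatrix {ι : Type*} (a b : ℝ) (Y : ι → ℝ → ℝ) : Matrix ι ι ℝ :=
  Matrix.of fun i j => ∫ t in a..b, Y i t * Y j t

/-- The weak (negative) Laplacian `-Δ_Y = ⟨(Y')ᵀ, Y'⟩` in `L²(a,b)`. The basis functions are
piecewise polynomial, so that `deriv` is their weak derivative away from the finitely many
nodes. -/
def negLaplacian {ι : Type*} (a b : ℝ) (Y : ι → ℝ → ℝ) : Matrix ι ι ℝ :=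
  Matrix.of fun i j => ∫ t in a..b, deriv (Y i) t * deriv (Y j) t

/-- The matrix `A_Y = -Δ_Y + (ω²/2) M_Y`. -/
def screenedMatrix {ι : Type*} (a b ω : ℝ) (Y : ι → ℝ → ℝ) : Matrix ι ι ℝ :=
  negLaplacian a b Y + (ω ^ 2 / 2) • massMatrix a b Y

/-- The matrix `L^{-T} M_Y L^{-1}`. -/
def transformedMass {ι : Type*} [Fintype ι] [DecidableEq ι] (a b : ℝ) (Y : ι → ℝ → ℝ)
    (L : Matrix ι ι ℝ) : Matrix ι ι ℝ :=
  Matrix.transpose L⁻¹ * massMatrix a b Y * L⁻¹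

/-- The (complex) spectrum of a real square matrix. -/
def matSpectrum {ι : Type*} [Fintype ι] [DecidableEq ι] (A : Matrix ι ι ℝ) : Set ℂ :=
  spectrum ℂ (A.map ((↑) : ℝ → ℂ))

/-- The constant `max(1, 2/ω²)`; only used for `ω ≠ 0`. -/
def neumannConst (ω : ℝ) : ℝ := max 1 (2 / ω ^ 2)

/-- The constant `min((b-a)²/π², max(1, 2/ω²))`, with `2/ω² = +∞` when `ω = 0`. -/
def dirichletConst (a b ω : ℝ) : ℝ :=
  if ω = 0 then (b - a) ^ 2 / Real.pi ^ 2
  else min ((b - a) ^ 2 / Real.pi ^ 2) (max 1 (2 / ω ^ 2))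

/-- The lower bound `2h² / (24p⁴ + ω²h²)`. -/
def lowerBound (p : ℕ) (ω h : ℝ) : ℝ :=
  2 * h ^ 2 / (24 * (p : ℝ) ^ 4 + ω ^ 2 * h ^ 2)

end

end HpFEM

/-! Write M for the mass matrix and A = LᵀL. An eigenvalue r of L⁻ᵀML⁻¹ satisfies M y = r A y for
some real y ≠ 0, so it lies between any bounds for the Rayleigh quotient yᵀMy / yᵀAy
(`matSpectrum_congr_subset`). With u = Σ yᵢYᵢ this quotient is ‖u‖² / (‖u'‖² + (ω²/2)‖u‖²), where u'
is taken cell by cell. Linear independence of the basis makes A positive definite and hence L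
invertible.

The lower bound is the inverse estimate ‖u'‖² ≤ (12p⁴/h²)‖u‖², obtained by scaling the L² Markov
inequality to each cell. `markov_symmIntegral` is proved by induction on the degree: the top-degree
Legendre component is split off, its derivative has an explicitly known norm, and the constants of
the two pieces add up to the next one.

The upper bound 2/ω² comes from dropping ‖u'‖². In the Dirichlet case `poincare_piecewise` gives the
sharp constant (b-a)²/π² by comparing u with a cosine (a Picone-type identity), whose boundary terms
telescope over the cells. -/

namespace HpFEM
open Polynomial

/-! ### Integration over the reference interval and orthogonal polynomials -/

/-- Integration of polynomials over `[-1,1]`. -/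
noncomputable def symmIntegral : ℝ[X] →ₗ[ℝ] ℝ where
  toFun f := ∫ t in (-1 : ℝ)..1, f.eval t
  map_add' f g := by
    simp only [eval_add]
    exact intervalIntegral.integral_add (f.continuous.intervalIntegrable _ _)
      (g.continuous.intervalIntegrable _ _)
  map_smul' c f := by
    simp only [eval_smul, smul_eq_mul, RingHom.id_apply]
    exact intervalIntegral.integral_const_mul _ _

theorem symmIntegral_apply (f : ℝ[X]) : symmIntegral f = ∫ t in (-1 : ℝ)..1, f.eval t := rfl

theorem symmIntegral_derivative (f : ℝ[X]) :
    symmIntegral (derivative f) = f.eval 1 - f.eval (-1) :=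
  intervalIntegral.integral_eq_sub_of_hasDerivAt (fun t _ => f.hasDerivAt t)
    ((derivative f).continuous.intervalIntegrable _ _)

theorem symmIntegral_mul_self_nonneg (f : ℝ[X]) : 0 ≤ symmIntegral (f * f) := by
  rw [symmIntegral_apply]
  refine intervalIntegral.integral_nonneg (by norm_num) fun t _ => ?_
  rw [eval_mul]
  exact mul_self_nonneg _

theorem polynomial_eq_zero_of_integral_sq {c d : ℝ} (hcd : c < d) {f : ℝ[X]}
    (h : ∫ t in c..d, f.eval t ^ 2 = 0) : f = 0 := by
  by_contra hf
  have hfin : {t : ℝ | f.IsRoot t}.Finite := f.finite_setOfPred_isRoot hf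
  have hinf : (Set.Icc c d \ {t : ℝ | f.IsRoot t}).Infinite :=
    (Set.Icc_infinite hcd).sdiff hfin
  obtain ⟨t, ht, htf⟩ := hinf.nonempty
  have hpos : 0 < ∫ t in c..d, f.eval t ^ 2 :=
    intervalIntegral.integral_pos hcd (f.continuous.pow 2).continuousOn
      (fun s _ => sq_nonneg _) ⟨t, ht, sq_pos_of_ne_zero htf⟩
  exact hpos.ne' h

theorem eq_zero_of_symmIntegral_mul_self {f : ℝ[X]} (h : symmIntegral (f * f) = 0) : f = 0 := by
  refine polynomial_eq_zero_of_integral_sq (c := -1) (d := 1) (by norm_num) ?_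
  rw [← h, symmIntegral_apply]
  simp [sq]

/-- Existence of the monic Legendre polynomials. -/
theorem exists_monic_orthogonal (p : ℕ) :
    ∃ P : ℝ[X], (P - X ^ p).degree < (p : WithBot ℕ) ∧
      ∀ q : ℝ[X], q.degree < (p : WithBot ℕ) → symmIntegral (P * q) = 0 := by
  let V := degreeLT ℝ p
  have : FiniteDimensional ℝ V := Module.Finite.equiv (degreeLTEquiv ℝ p).symm
  -- The L² form is definite on polynomials of degree < p, so it represents the functional q ↦ ∫ X^p
  -- q by some w. Then X^p - w is the orthogonal polynomial.
  let B : V →ₗ[ℝ] Module.Dual ℝ V :=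
    ((LinearMap.mul ℝ ℝ[X]).compr₂ symmIntegral).domRestrict₁₂ V V
  have hB : Function.Injective B := by
    refine (injective_iff_map_eq_zero B).2 fun f hf => ?_
    have h0 : symmIntegral ((f : ℝ[X]) * f) = 0 := LinearMap.congr_fun hf f
    exact Subtype.ext (eq_zero_of_symmIntegral_mul_self h0)
  have hS : Function.Surjective B :=
    (LinearMap.injective_iff_surjective_of_finrank_eq_finrank
      (Subspace.dual_finrank_eq (K := ℝ) (V := V)).symm).1 hB
  obtain ⟨w, hw⟩ := hS ((symmIntegral ∘ₗ LinearMap.mulLeft ℝ (X ^ p)) ∘ₗ V.subtype)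
  refine ⟨X ^ p - (w : ℝ[X]), ?_, fun q hq => ?_⟩
  · rw [sub_sub_cancel_left, degree_neg]
    exact mem_degreeLT.1 w.2
  · have h := LinearMap.congr_fun hw ⟨q, mem_degreeLT.2 hq⟩
    have h' : symmIntegral ((w : ℝ[X]) * q) = symmIntegral (X ^ p * q) := h
    rw [sub_mul, map_sub, h', sub_self]

theorem degree_derivative_legendreOp_lt {p : ℕ} {q : ℝ[X]} (hq : q.degree < (p : WithBot ℕ)) :
    (derivative ((1 - X ^ 2) * derivative q)).degree < (p : WithBot ℕ) := by
  rw [degree_lt_iff_coeff_zero] at hq ⊢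
  intro m hm
  have h1 : q.coeff m = 0 := hq m hm
  have h2 : q.coeff (m + 2) = 0 := hq _ (by omega)
  rw [sub_mul, one_mul, coeff_derivative, coeff_sub, coeff_X_pow_mul', coeff_derivative, h2]
  rcases m with _ | m
  · simp
  · simp [coeff_derivative, h1]

/-! ### Differential equation and norms of the monic Legendre polynomial -/

section Legendre

variable {p : ℕ} {P : ℝ[X]} (hP : (P - X ^ p).degree < (p : WithBot ℕ))
  (hort : ∀ q : ℝ[X], q.degree < (p : WithBot ℕ) → symmIntegral (P * q) = 0)

include hP

theorem coeff_eq_one_of_degree_sub : P.coeff p = 1 := by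
  have := (degree_lt_iff_coeff_zero _ _).1 hP p le_rfl
  rw [coeff_sub, coeff_X_pow_self] at this
  linarith

theorem coeff_eq_zero_of_degree_sub {m : ℕ} (hm : p < m) : P.coeff m = 0 := by
  have := (degree_lt_iff_coeff_zero _ _).1 hP m hm.le
  rw [coeff_sub, coeff_X_pow, if_neg hm.ne'] at this
  linarith

include hort

/-- The Legendre differential equation follows from orthogonality. -/
theorem legendre_ode : derivative ((1 - X ^ 2) * derivative P) + C ((p : ℝ) * (p + 1)) * P = 0 := by
  obtain ⟨R, hR⟩ : ∃ R, R = derivative ((1 - X ^ 2) * derivative P) + C ((p : ℝ) * (p + 1)) * P :=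
    ⟨_, rfl⟩
  rw [← hR]
  -- The factor p(p+1) is exactly what cancels the coefficient of X^p.
  have hdeg : R.degree < (p : WithBot ℕ) := by
    rw [degree_lt_iff_coeff_zero]
    intro m hm
    have h2 : P.coeff (m + 2) = 0 := coeff_eq_zero_of_degree_sub hP (by omega)
    rw [hR, coeff_add, coeff_C_mul, sub_mul, one_mul, coeff_derivative, coeff_sub, coeff_X_pow_mul',
      coeff_derivative, h2]
    rcases hm.eq_or_lt with rfl | hm
    · rcases p with _ | p
      · simp
      · simp only [coeff_derivative, coeff_eq_one_of_degree_sub hP]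
        simp [coeff_eq_one_of_degree_sub hP]
        ring
    · have h1 : P.coeff m = 0 := coeff_eq_zero_of_degree_sub hP hm
      rcases m with _ | m
      · simp at hm
      · simp [coeff_derivative, h1]
  refine eq_zero_of_symmIntegral_mul_self ?_
  -- Green's identity moves the Legendre operator from P to R. The boundary term carries the factor
  -- 1 - X², and what remains pairs P with polynomials of degree < p, so ∫ R² = 0.
  have e : R * R = derivative ((1 - X ^ 2) * (derivative P * R - P * derivative R)) +
      (P * derivative ((1 - X ^ 2) * derivative R) + C ((p : ℝ) * (p + 1)) * (P * R)) := by
    nth_rewrite 1 [hR]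
    simp only [derivative_mul, derivative_sub]
    ring
  rw [e, map_add, map_add, symmIntegral_derivative, hort _ (degree_derivative_legendreOp_lt hdeg),
    ← smul_eq_C_mul, map_smul, hort _ hdeg]
  simp

/-- Integrate (X P²)' = (2p+1) P² + 2 P (X P' - p P). The bracket has degree < p because P is monic
of degree p, so its product with P integrates to zero. -/
theorem legendre_norm :
    (2 * (p : ℝ) + 1) * symmIntegral (P * P) = P.eval 1 ^ 2 + P.eval (-1) ^ 2 := by
  have hdeg : (X * derivative P - C (p : ℝ) * P).degree < (p : WithBot ℕ) := by
    rw [degree_lt_iff_coeff_zero]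
    intro m hm
    rw [coeff_sub, coeff_C_mul]
    rcases hm.eq_or_lt with rfl | hm
    · rcases p with _ | p
      · simp
      · simp only [coeff_X_mul, coeff_derivative]
        push_cast
        ring
    · have h1 : P.coeff m = 0 := coeff_eq_zero_of_degree_sub hP hm
      rcases m with _ | m
      · simp at hm
      · simp [coeff_X_mul, coeff_derivative, h1]
  have e : derivative (X * (P * P)) = (2 * (p : ℝ) + 1) • (P * P) +
      (2 : ℝ) • (P * (X * derivative P - C (p : ℝ) * P)) := by
    simp only [derivative_mul, derivative_X, smul_eq_C_mul, C_add, C_mul, C_1]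
    rw [show (C (2 : ℝ) : ℝ[X]) = 2 from rfl]
    ring
  have h := symmIntegral_derivative (X * (P * P))
  rw [e, map_add, map_smul, map_smul, hort _ hdeg] at h
  simp only [smul_eq_mul, mul_zero, add_zero, eval_mul, eval_X] at h
  linarith

/-- Integration by parts leaves only the boundary values of P P', since P'' is orthogonal to P. The
differential equation at ±1 gives P'(±1) = ±p(p+1)/2 · P(±1), and `legendre_norm` turns the endpoint
values back into ∫ P². -/
theorem legendre_derivative_norm :
    symmIntegral (derivative P * derivative P) =
      (p : ℝ) * (p + 1) * (2 * p + 1) / 2 * symmIntegral (P * P) := by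
  have hdeg : (derivative (derivative P)).degree < (p : WithBot ℕ) := by
    rw [degree_lt_iff_coeff_zero]
    intro m hm
    rw [coeff_derivative, coeff_derivative, coeff_eq_zero_of_degree_sub hP (by omega)]
    simp
  have e : derivative P * derivative P =
      derivative (P * derivative P) - P * derivative (derivative P) := by
    simp only [derivative_mul]
    ring
  have hode := legendre_ode hP hort
  have h1 := congrArg (eval 1) hode
  have h2 := congrArg (eval (-1)) hode
  simp [derivative_mul] at h1 h2
  have hn := legendre_norm hP hort
  rw [e, map_sub, hort _ hdeg, symmIntegral_derivative, eval_mul, eval_mul]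
  have : (p : ℝ) * (p + 1) * (2 * p + 1) / 2 * symmIntegral (P * P) =
      p * (p + 1) / 2 * ((2 * (p : ℝ) + 1) * symmIntegral (P * P)) := by ring
  rw [this, hn]
  linear_combination (- eval 1 P / 2) * h1 - (eval (-1) P / 2) * h2

end Legendre

/-! ### Markov's inequality and its scaling to a cell -/

/-- This is √(Ax) + √(By) ≤ √(A+B) √(x+y), with the cross term bounded by expanding ‖Bf - Ag‖² ≥ 0.
The degenerate value A = 0 is needed: it is the Markov constant in degree zero. -/
theorem symmIntegral_mul_add_sq_le {f g : ℝ[X]} {A B x y : ℝ} (hA : 0 ≤ A) (hB : 0 < B)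
    (hf : symmIntegral (f * f) ≤ A * x) (hg : symmIntegral (g * g) = B * y)
    (hx : 0 ≤ x) :
    symmIntegral ((f + g) * (f + g)) ≤ (A + B) * (x + y) := by
  have h := symmIntegral_mul_self_nonneg (B • f - A • g)
  have e1 : (B • f - A • g) * (B • f - A • g) =
      B ^ 2 • (f * f) - (2 * A * B) • (f * g) + A ^ 2 • (g * g) := by
    simp only [smul_eq_C_mul, C_mul, C_pow]
    rw [show (C (2 : ℝ) : ℝ[X]) = 2 from rfl]
    ring
  have e2 : (f + g) * (f + g) = f * f + (2 : ℝ) • (f * g) + g * g := by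
    rw [smul_eq_C_mul, show (C (2 : ℝ) : ℝ[X]) = 2 from rfl]
    ring
  rw [e1] at h
  simp only [map_add, map_sub, map_smul, smul_eq_mul] at h
  rw [e2]
  simp only [map_add, map_smul, smul_eq_mul]
  rcases hA.eq_or_lt with rfl | hA
  · have hf0 : f = 0 := eq_zero_of_symmIntegral_mul_self
      (le_antisymm (by linarith) (symmIntegral_mul_self_nonneg f))
    subst hf0
    have : 0 ≤ B * x := by positivity
    simp only [zero_mul, map_zero, hg]
    linarith
  · set u := symmIntegral (f * f)
    set v := symmIntegral (f * g)
    rw [hg] at h ⊢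
    have h3 : 2 * v ≤ B / A * u + A * y := by
      rw [← sub_nonneg]
      have : B / A * u + A * y - 2 * v =
          (B ^ 2 * u - 2 * A * B * v + A ^ 2 * (B * y)) / (A * B) := by
        field_simp
        ring
      rw [this]
      positivity
    have h4 : B / A * u ≤ B * x := by
      have := mul_le_mul_of_nonneg_left hf (by positivity : 0 ≤ B / A)
      calc _ ≤ _ := this
        _ = _ := by field_simp
    nlinarith

/-- Markov's inequality in `L²(-1,1)`. -/
theorem markov_symmIntegral (p : ℕ) (q : ℝ[X]) (hq : q.natDegree ≤ p) :
    symmIntegral (derivative q * derivative q) ≤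
      (p : ℝ) * (p + 1) ^ 2 * (p + 2) / 4 * symmIntegral (q * q) := by
  induction p generalizing q with
  | zero => simp [derivative_of_natDegree_zero (Nat.le_zero.1 hq)]
  | succ p ih =>
    obtain ⟨P, hP, hort⟩ := exists_monic_orthogonal (p + 1)
    set c := q.coeff (p + 1)
    set f := q - C c * P with hf
    have hdeg : f.degree < ((p + 1 : ℕ) : WithBot ℕ) := by
      rw [degree_lt_iff_coeff_zero]
      intro m hm
      rw [hf, coeff_sub, coeff_C_mul]
      rcases hm.eq_or_lt with rfl | hm
      · rw [coeff_eq_one_of_degree_sub hP, mul_one, sub_self]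
      · rw [coeff_eq_zero_of_degree_sub hP hm, coeff_eq_zero_of_natDegree_lt (by omega)]
        simp
    have hnat : f.natDegree ≤ p := by
      rw [natDegree_le_iff_coeff_eq_zero]
      exact fun m hm => (degree_lt_iff_coeff_zero _ _).1 hdeg m hm
    have hq' : q = f + c • P := by
      rw [hf, smul_eq_C_mul]
      ring
    have hg : symmIntegral (derivative (c • P) * derivative (c • P)) =
        ((p + 1 : ℕ) : ℝ) * ((p + 1 : ℕ) + 1) * (2 * (p + 1 : ℕ) + 1) / 2 *
          symmIntegral ((c • P) * (c • P)) := by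
      rw [derivative_smul]
      simp only [smul_mul_smul_comm, map_smul, smul_eq_mul,
        legendre_derivative_norm hP hort]
      ring
    have hsq : symmIntegral (q * q) = symmIntegral (f * f) + symmIntegral ((c • P) * (c • P)) := by
      have e : q * q = f * f + (2 * c) • (P * f) + (c • P) * (c • P) := by
        rw [hq', smul_eq_C_mul, smul_eq_C_mul, C_mul, show (C (2 : ℝ) : ℝ[X]) = 2 from rfl]
        ring
      rw [e, map_add, map_add, map_smul, hort _ hdeg]
      simp
    have hfin := symmIntegral_mul_add_sq_le (by positivity) (by positivity) (ih f hnat) hg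
      (symmIntegral_mul_self_nonneg _)
    rw [hsq, hq', derivative_add]
    -- The constants telescope: p(p+1)²(p+2)/4 + (p+1)(p+2)(2p+3)/2 = (p+1)(p+2)²(p+3)/4.
    refine hfin.trans (le_of_eq ?_)
    push_cast
    ring

/-- The inverse inequality for polynomials of degree at most `p` on a cell `[c,d]`. -/
theorem integral_derivative_sq_le {p : ℕ} (hp : 1 ≤ p) {q : ℝ[X]} (hq : q.natDegree ≤ p) {c d : ℝ}
    (hcd : c < d) :
    ∫ t in c..d, (derivative q).eval t ^ 2 ≤
      12 * (p : ℝ) ^ 4 / (d - c) ^ 2 * ∫ t in c..d, q.eval t ^ 2 := by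
  have hδ : 0 < d - c := sub_pos.2 hcd
  have hs : (d - c) / 2 ≠ 0 := by positivity
  set r := q.comp (C ((d - c) / 2) * X + C ((c + d) / 2)) with hr
  have hrd : r.natDegree ≤ p := by
    rw [hr, natDegree_comp, natDegree_linear hs, mul_one]
    exact hq
  have hcov : ∀ f : ℝ[X], ∫ t in c..d, f.eval t ^ 2 =
      (d - c) / 2 * ∫ t in (-1 : ℝ)..1, f.eval ((d - c) / 2 * t + (c + d) / 2) ^ 2 := by
    intro f
    rw [intervalIntegral.mul_integral_comp_mul_add (f := fun t => f.eval t ^ 2)]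
    congr 1 <;> ring
  have h1 : symmIntegral (r * r) =
      ∫ t in (-1 : ℝ)..1, q.eval ((d - c) / 2 * t + (c + d) / 2) ^ 2 := by
    rw [symmIntegral_apply]
    simp [hr, sq]
  have h2 : symmIntegral (derivative r * derivative r) = ((d - c) / 2) ^ 2 *
      ∫ t in (-1 : ℝ)..1, (derivative q).eval ((d - c) / 2 * t + (c + d) / 2) ^ 2 := by
    rw [symmIntegral_apply, ← intervalIntegral.integral_const_mul]
    congr 1
    funext t
    simp [hr, derivative_comp]
    ring
  have hM := markov_symmIntegral p r hrd
  have hp' : (1 : ℝ) ≤ p := by exact_mod_cast hp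
  -- For p ≥ 1 one has p+1 ≤ 2p and p+2 ≤ 3p. The resulting 3p⁴, times (2/(d-c))² from the change of
  -- variables, gives the 12p⁴.
  have hconst : (p : ℝ) * (p + 1) ^ 2 * (p + 2) / 4 ≤ 3 * (p : ℝ) ^ 4 := by
    have e1 : ((p : ℝ) + 1) ^ 2 ≤ (2 * p) ^ 2 := by gcongr; linarith
    have e2 : (p : ℝ) + 2 ≤ 3 * p := by linarith
    calc (p : ℝ) * (p + 1) ^ 2 * (p + 2) / 4 ≤ (p : ℝ) * (2 * p) ^ 2 * (3 * p) / 4 := by gcongr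
      _ = _ := by ring
  have hM' := hM.trans (mul_le_mul_of_nonneg_right hconst (symmIntegral_mul_self_nonneg r))
  rw [h1, h2] at hM'
  rw [hcov, hcov]
  set A := ∫ t in (-1 : ℝ)..1, (derivative q).eval ((d - c) / 2 * t + (c + d) / 2) ^ 2
  set B := ∫ t in (-1 : ℝ)..1, q.eval ((d - c) / 2 * t + (c + d) / 2) ^ 2
  calc (d - c) / 2 * A = 2 / (d - c) * (((d - c) / 2) ^ 2 * A) := by field_simp
    _ ≤ 2 / (d - c) * (3 * (p : ℝ) ^ 4 * B) := by gcongr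
    _ = _ := by field_simp; ring

/-! ### Generalized Rayleigh quotients -/

section Spectrum

variable {ι : Type*} [Fintype ι] [DecidableEq ι]

open Matrix in
/-- The spectrum of a congruence transform is located by the generalized Rayleigh quotient. -/
theorem matSpectrum_congr_subset {L M : Matrix ι ι ℝ} (hM : M.IsSymm) {lo hi : ℝ}
    (hpos : ∀ v : ι → ℝ, v ≠ 0 → 0 < v ⬝ᵥ ((Lᵀ * L) *ᵥ v))
    (hlo : ∀ v : ι → ℝ, lo * (v ⬝ᵥ ((Lᵀ * L) *ᵥ v)) ≤ v ⬝ᵥ (M *ᵥ v))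
    (hhi : ∀ v : ι → ℝ, v ⬝ᵥ (M *ᵥ v) ≤ hi * (v ⬝ᵥ ((Lᵀ * L) *ᵥ v))) :
    IsUnit L ∧ matSpectrum (L⁻¹ᵀ * M * L⁻¹) ⊆ ((↑) : ℝ → ℂ) '' Set.Icc lo hi := by
  have hL : IsUnit L := by
    rw [Matrix.isUnit_iff_isUnit_det, isUnit_iff_ne_zero]
    intro hdet
    obtain ⟨v, hv, hLv⟩ := Matrix.exists_mulVec_eq_zero_iff.2 hdet
    have := hpos v hv
    rw [← Matrix.mulVec_mulVec, hLv] at this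
    simp at this
  refine ⟨hL, fun z hz => ?_⟩
  have hdet : IsUnit L.det := (Matrix.isUnit_iff_isUnit_det L).1 hL
  set N := L⁻¹ᵀ * M * L⁻¹ with hN
  have hNs : Nᵀ = N := by
    simp only [hN, Matrix.transpose_mul, Matrix.transpose_transpose, hM.eq, Matrix.mul_assoc]
  have hherm : (N.map ((↑) : ℝ → ℂ)).IsHermitian := by
    ext i j
    simp only [Matrix.conjTranspose_apply, Matrix.map_apply, Complex.star_def, Complex.conj_ofReal]
    rw [← Matrix.transpose_apply N, hNs]
  have hz' := hz
  rw [matSpectrum, hherm.spectrum_eq_image_range] at hz'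
  obtain ⟨r, -, rfl⟩ := hz'
  refine ⟨r, ?_, rfl⟩
  -- The eigenvalue is real, so singularity is pulled back from ℂ to ℝ in order to get a real
  -- eigenvector.
  have hdet0 : (algebraMap ℝ (Matrix ι ι ℝ) r - N).det = 0 := by
    by_contra hne
    have hu : IsUnit (algebraMap ℝ (Matrix ι ι ℝ) r - N) :=
      (Matrix.isUnit_iff_isUnit_det _).2 (isUnit_iff_ne_zero.2 hne)
    have hu' := hu.map (Complex.ofRealHom.mapMatrix (m := ι))
    refine hz ?_
    change IsUnit (algebraMap ℂ (Matrix ι ι ℂ) r - N.map ((↑) : ℝ → ℂ))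
    convert hu' using 1
    ext i j
    simp [Matrix.algebraMap_matrix_apply, apply_ite]
  obtain ⟨w, hw, hNw⟩ := Matrix.exists_mulVec_eq_zero_iff.2 hdet0
  have hNw' : N *ᵥ w = r • w := by
    rw [Matrix.sub_mulVec, sub_eq_zero] at hNw
    rw [← hNw, Algebra.algebraMap_eq_smul_one, Matrix.smul_mulVec, Matrix.one_mulVec]
  set y := L⁻¹ *ᵥ w with hy
  have hLy : L *ᵥ y = w := by
    rw [hy, Matrix.mulVec_mulVec, Matrix.mul_nonsing_inv _ hdet, Matrix.one_mulVec]
  have hy0 : y ≠ 0 := by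
    intro h
    rw [h, Matrix.mulVec_zero] at hLy
    exact hw hLy.symm
  have hMy : M *ᵥ y = r • ((Lᵀ * L) *ᵥ y) := by
    have h1 : Lᵀ *ᵥ (N *ᵥ w) = M *ᵥ y := by
      rw [hN, hy, Matrix.mulVec_mulVec, Matrix.mulVec_mulVec, ← Matrix.mul_assoc,
        ← Matrix.mul_assoc, ← Matrix.transpose_mul, Matrix.nonsing_inv_mul _ hdet,
        Matrix.transpose_one, Matrix.one_mul]
    rw [← h1, hNw', Matrix.mulVec_smul, ← Matrix.mulVec_mulVec, hLy]
  have hp := hpos y hy0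
  have h1 := hlo y
  have h2 := hhi y
  rw [hMy, dotProduct_smul, smul_eq_mul] at h1 h2
  exact ⟨le_of_mul_le_mul_right h1 hp, le_of_mul_le_mul_right h2 hp⟩

end Spectrum

/-! ### Quadratic forms and inequalities for piecewise polynomials -/

section PiecewisePolynomial

theorem IsSubdivision.mono {a b : ℝ} {n : ℕ} {x : ℕ → ℝ} (hx : IsSubdivision a b n x)
    {i j : ℕ} (hij : i ≤ j) (hj : j ≤ n) : x i ≤ x j := by
  induction j, hij using Nat.le_induction with
  | base => exact le_rfl
  | succ j _ ih => exact (ih (by omega)).trans (hx.lt_succ j (by omega)).le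

variable {ι : Type*} [Fintype ι] {a b : ℝ} {n : ℕ} {x : ℕ → ℝ}

theorem integral_mul_eq_sum_cells (hx : IsSubdivision a b n x) {f g : ℝ → ℝ} {F G : Fin n → ℝ[X]}
    (hf : ∀ j : Fin n, Set.EqOn f (fun t => (F j).eval t) (Set.Ioo (x j) (x (j + 1))))
    (hg : ∀ j : Fin n, Set.EqOn g (fun t => (G j).eval t) (Set.Ioo (x j) (x (j + 1)))) :
    ∫ t in a..b, f t * g t = ∑ j : Fin n, ∫ t in x j..x (j + 1), (F j * G j).eval t := by
  have hcell : ∀ j : Fin n, Set.EqOn (fun t => (F j * G j).eval t) (fun t => f t * g t)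
      (Set.uIoo (x j) (x (j + 1))) := by
    intro j t ht
    rw [Set.uIoo_of_le (hx.lt_succ j j.2).le] at ht
    simp only [hf j ht, hg j ht, eval_mul]
  rw [← hx.left, ← hx.right, ← intervalIntegral.sum_integral_adjacent_intervals, Finset.sum_range]
  · refine Finset.sum_congr rfl fun j _ => ?_
    exact (intervalIntegral.integral_congr_uIoo (hcell j)).symm
  · intro k hk
    exact (((F ⟨k, hk⟩ * G ⟨k, hk⟩).continuous).intervalIntegrable _ _).congr_uIoo (hcell ⟨k, hk⟩)

open Matrix in
theorem quadForm_gram (hx : IsSubdivision a b n x) {f : ι → ℝ → ℝ} {F : ι → Fin n → ℝ[X]}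
    (hf : ∀ i, ∀ j : Fin n, Set.EqOn (f i) (fun t => (F i j).eval t) (Set.Ioo (x j) (x (j + 1))))
    (v : ι → ℝ) :
    v ⬝ᵥ ((Matrix.of fun i k => ∫ t in a..b, f i t * f k t) *ᵥ v) =
      ∑ j : Fin n, ∫ t in x j..x (j + 1), ((∑ i, v i • F i) j).eval t ^ 2 := by
  have h : ∀ j : Fin n, ∫ t in x j..x (j + 1), ((∑ i, v i • F i) j).eval t ^ 2 =
      ∑ i, ∑ k, v i * v k * ∫ t in x j..x (j + 1), (F i j * F k j).eval t := by
    intro j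
    have e : ∀ t, ((∑ i, v i • F i) j).eval t ^ 2 =
        ∑ i, ∑ k, v i * v k * (F i j * F k j).eval t := by
      intro t
      simp only [Finset.sum_apply, Pi.smul_apply, eval_finsetSum, eval_smul, smul_eq_mul, sq,
        Finset.sum_mul_sum, eval_mul]
      exact Finset.sum_congr rfl fun _ _ => Finset.sum_congr rfl fun _ _ => by ring
    simp only [e]
    rw [intervalIntegral.integral_finsetSum]
    · refine Finset.sum_congr rfl fun i _ => ?_
      rw [intervalIntegral.integral_finsetSum]
      · exact Finset.sum_congr rfl fun k _ => intervalIntegral.integral_const_mul _ _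
      · exact fun k _ => (((F i j * F k j).continuous).const_mul _).intervalIntegrable _ _
    · exact fun i _ => (continuous_finsetSum _ fun k _ =>
        ((F i j * F k j).continuous).const_mul _).intervalIntegrable _ _
  simp only [h]
  rw [Finset.sum_comm]
  simp only [dotProduct, Matrix.mulVec, Matrix.of_apply, Finset.mul_sum]
  refine Finset.sum_congr rfl fun i _ => ?_
  rw [Finset.sum_comm]
  refine Finset.sum_congr rfl fun k _ => ?_
  rw [integral_mul_eq_sum_cells hx (hf i) (hf k), Finset.sum_mul, Finset.mul_sum]
  exact Finset.sum_congr rfl fun j _ => by ring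

/-- `Y i` agrees with the polynomial `F i j` on the `j`-th closed cell. -/
def IsPiecewise (x : ℕ → ℝ) (Y : ι → ℝ → ℝ) (F : ι → Fin n → ℝ[X]) : Prop :=
  ∀ i, ∀ j : Fin n, ∀ t, x j ≤ t → t ≤ x (j + 1) → Y i t = (F i j).eval t

open Matrix in
theorem quadForm_mass (hx : IsSubdivision a b n x) {Y : ι → ℝ → ℝ} {F : ι → Fin n → ℝ[X]}
    (hY : IsPiecewise x Y F) (v : ι → ℝ) :
    v ⬝ᵥ (massMatrix a b Y *ᵥ v) =
      ∑ j : Fin n, ∫ t in x j..x (j + 1), ((∑ i, v i • F i) j).eval t ^ 2 :=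
  quadForm_gram hx (fun i j t ht => hY i j t ht.1.le ht.2.le) v

open Matrix in
theorem quadForm_negLaplacian (hx : IsSubdivision a b n x) {Y : ι → ℝ → ℝ}
    {F : ι → Fin n → ℝ[X]} (hY : IsPiecewise x Y F) (v : ι → ℝ) :
    v ⬝ᵥ (negLaplacian a b Y *ᵥ v) =
      ∑ j : Fin n, ∫ t in x j..x (j + 1), (derivative ((∑ i, v i • F i) j)).eval t ^ 2 := by
  have h := quadForm_gram hx (f := fun i => deriv (Y i)) (F := fun i j => derivative (F i j))
    (fun i j t ht => ?_) v
  · refine h.trans (Finset.sum_congr rfl fun j _ => ?_)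
    simp only [Finset.sum_apply, Pi.smul_apply, derivative_sum, derivative_smul]
  -- Only open cells matter, so the value of `deriv` at a kink is irrelevant.
  · have hev : Y i =ᶠ[nhds t] fun s => (F i j).eval s :=
      Filter.eventually_of_mem (isOpen_Ioo.mem_nhds ht) fun s hs => hY i j s hs.1.le hs.2.le
    rw [hev.deriv_eq, Polynomial.deriv]

/-- Picone's identity for the solution cos(κ(t-m)) of φ'' + κ²φ = 0: the derivative of κ tan(κ(t-m))
q² equals (q' + κ tan(κ(t-m)) q)² - q'² + κ²q². Integrate and drop the square. -/
theorem poincare_cell {q : ℝ[X]} {c d m κ : ℝ} (hcd : c ≤ d)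
    (hcos : ∀ t ∈ Set.Icc c d, 0 < Real.cos (κ * (t - m))) :
    κ * Real.tan (κ * (c - m)) * q.eval c ^ 2 - κ * Real.tan (κ * (d - m)) * q.eval d ^ 2 ≤
      (∫ t in c..d, (derivative q).eval t ^ 2) - κ ^ 2 * ∫ t in c..d, q.eval t ^ 2 := by
  set T : ℝ → ℝ := fun t => κ * Real.tan (κ * (t - m)) * q.eval t ^ 2 with hT
  have hd : ∀ t ∈ Set.Icc c d, HasDerivAt T
      ((((derivative q).eval t + κ * Real.tan (κ * (t - m)) * q.eval t) ^ 2
        - (derivative q).eval t ^ 2) + κ ^ 2 * q.eval t ^ 2) t := by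
    intro t ht
    have hc : Real.cos (κ * (t - m)) ≠ 0 := (hcos t ht).ne'
    have h1 : HasDerivAt (fun s => κ * (s - m)) (κ * 1) t :=
      ((hasDerivAt_id t).sub_const m).const_mul κ
    have h2 := (((Real.hasDerivAt_tan hc).comp t h1).const_mul κ).mul ((q.hasDerivAt t).pow 2)
    refine h2.congr_deriv ?_
    have htan : 1 / Real.cos (κ * (t - m)) ^ 2 = 1 + Real.tan (κ * (t - m)) ^ 2 := by
      rw [Real.tan_eq_sin_div_cos]
      field_simp
      rw [add_comm, Real.sin_sq_add_cos_sq]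
    simp only [Function.comp_apply, Pi.pow_apply, htan]
    push_cast
    ring
  have htanc : ContinuousOn (fun t => Real.tan (κ * (t - m))) (Set.Icc c d) := fun t ht =>
    (ContinuousAt.comp (f := fun t => κ * (t - m))
      (Real.continuousAt_tan.2 (hcos t ht).ne') (by fun_prop)).continuousWithinAt
  have hI1 : IntervalIntegrable (fun t => ((derivative q).eval t +
      κ * Real.tan (κ * (t - m)) * q.eval t) ^ 2) MeasureTheory.volume c d := by
    refine ContinuousOn.intervalIntegrable_of_Icc hcd ?_
    exact (((derivative q).continuousOn).add
      ((continuousOn_const.mul htanc).mul q.continuousOn)).pow 2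
  have hI2 : IntervalIntegrable (fun t => (derivative q).eval t ^ 2) MeasureTheory.volume c d :=
    ((derivative q).continuous.pow 2).intervalIntegrable _ _
  have hI3 : IntervalIntegrable (fun t => κ ^ 2 * q.eval t ^ 2) MeasureTheory.volume c d :=
    ((q.continuous.pow 2).const_mul _).intervalIntegrable _ _
  have hFTC := intervalIntegral.integral_eq_sub_of_hasDerivAt
    (fun t ht => hd t (by rwa [Set.uIcc_of_le hcd] at ht)) ((hI1.sub hI2).add hI3)
  rw [intervalIntegral.integral_add (hI1.sub hI2) hI3, intervalIntegral.integral_sub hI1 hI2,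
    intervalIntegral.integral_const_mul] at hFTC
  have hnn : 0 ≤ ∫ t in c..d, ((derivative q).eval t +
      κ * Real.tan (κ * (t - m)) * q.eval t) ^ 2 :=
    intervalIntegral.integral_nonneg hcd fun t _ => sq_nonneg _
  simp only [hT] at hFTC
  linarith

/-- The Poincaré-Friedrichs inequality with the optimal constant, for continuous piecewise
polynomials vanishing at both ends. -/
theorem poincare_piecewise (hab : a < b) (hx : IsSubdivision a b n x) {u : ℝ → ℝ}
    {q : Fin n → ℝ[X]} (hu : ∀ j : Fin n, ∀ t, x j ≤ t → t ≤ x (j + 1) → u t = (q j).eval t)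
    (ha : u a = 0) (hb : u b = 0) :
    ∑ j : Fin n, ∫ t in x j..x (j + 1), (q j).eval t ^ 2 ≤
      (b - a) ^ 2 / Real.pi ^ 2 *
        ∑ j : Fin n, ∫ t in x j..x (j + 1), (derivative (q j)).eval t ^ 2 := by
  have hba : 0 < b - a := sub_pos.2 hab
  set A := ∑ j : Fin n, ∫ t in x j..x (j + 1), (derivative (q j)).eval t ^ 2
  set B := ∑ j : Fin n, ∫ t in x j..x (j + 1), (q j).eval t ^ 2
  -- Strictly below π/(b-a) the cosine centred at the midpoint is positive on all of [a,b]; at the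
  -- critical value its tangent blows up at both ends. The sharp constant is recovered as a limit.
  have key : ∀ κ ∈ Set.Ioo 0 (Real.pi / (b - a)), κ ^ 2 * B ≤ A := by
    intro κ ⟨h0, h1⟩
    rw [lt_div_iff₀ hba] at h1
    have hcos : ∀ t ∈ Set.Icc a b, 0 < Real.cos (κ * (t - (a + b) / 2)) := by
      intro t ht
      have e1 : κ * (t - (a + b) / 2) ≤ κ * ((b - a) / 2) := by
        gcongr; linarith [ht.2]
      have e2 : κ * (-((b - a) / 2)) ≤ κ * (t - (a + b) / 2) := by
        gcongr; linarith [ht.1]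
      exact Real.cos_pos_of_mem_Ioo ⟨by linarith, by linarith⟩
    have hcell : ∀ j : Fin n,
        κ * Real.tan (κ * (x j - (a + b) / 2)) * u (x j) ^ 2 -
          κ * Real.tan (κ * (x (j + 1) - (a + b) / 2)) * u (x (j + 1)) ^ 2 ≤
        (∫ t in x j..x (j + 1), (derivative (q j)).eval t ^ 2) -
          κ ^ 2 * ∫ t in x j..x (j + 1), (q j).eval t ^ 2 := by
      intro j
      have hj := (hx.lt_succ j j.2).le
      rw [hu j _ le_rfl hj, hu j _ hj le_rfl]
      refine poincare_cell hj fun t ht => hcos t ⟨?_, ?_⟩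
      · rw [← hx.left]
        exact (hx.mono (Nat.zero_le _) j.2.le).trans ht.1
      · rw [← hx.right]
        exact ht.2.trans (hx.mono j.2 le_rfl)
    -- Adjacent polynomials share the nodal value of u, so the boundary terms telescope, and u
    -- vanishes at the two that survive.
    have hsum := Finset.sum_le_sum fun j (_ : j ∈ Finset.univ) => hcell j
    rw [Finset.sum_sub_distrib (s := Finset.univ)
      (f := fun j : Fin n => ∫ t in x j..x (j + 1), (derivative (q j)).eval t ^ 2),
      ← Finset.mul_sum,
      Fin.sum_univ_eq_sum_range (fun j => κ * Real.tan (κ * (x j - (a + b) / 2)) * u (x j) ^ 2 -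
          κ * Real.tan (κ * (x (j + 1) - (a + b) / 2)) * u (x (j + 1)) ^ 2) n,
      Finset.sum_range_sub' (fun j => κ * Real.tan (κ * (x j - (a + b) / 2)) * u (x j) ^ 2),
      hx.left, hx.right, ha, hb] at hsum
    have : 0 ≤ A - κ ^ 2 * B := by simpa using hsum
    linarith
  have hpos : 0 < Real.pi / (b - a) := div_pos Real.pi_pos hba
  have hlim : (Real.pi / (b - a)) ^ 2 * B ≤ A := by
    have ht : Filter.Tendsto (fun κ : ℝ => κ ^ 2 * B) (nhdsWithin (Real.pi / (b - a))
        (Set.Iio (Real.pi / (b - a)))) (nhds ((Real.pi / (b - a)) ^ 2 * B)) :=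
      ((by fun_prop : Continuous fun κ : ℝ => κ ^ 2 * B).tendsto _).mono_left nhdsWithin_le_nhds
    exact le_of_tendsto ht (Filter.eventually_of_mem (Ioo_mem_nhdsLT hpos) key)
  have hpi := Real.pi_pos
  calc B = (b - a) ^ 2 / Real.pi ^ 2 * ((Real.pi / (b - a)) ^ 2 * B) := by field_simp
    _ ≤ _ := by gcongr

theorem meshSize_le (j : Fin n) : meshSize n x ≤ x (j + 1) - x j :=
  ciInf_le (Set.finite_range _).bddBelow j

theorem IsSubdivision.pos (hab : a < b) (hx : IsSubdivision a b n x) : 0 < n := by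
  rcases Nat.eq_zero_or_pos n with rfl | h
  · exact absurd (hx.left.symm.trans hx.right) hab.ne
  · exact h

theorem meshSize_pos (hab : a < b) (hx : IsSubdivision a b n x) : 0 < meshSize n x := by
  have : Nonempty (Fin n) := ⟨⟨0, hx.pos hab⟩⟩
  obtain ⟨j, hj⟩ := exists_eq_ciInf_of_finite (f := fun j : Fin n => x (j + 1) - x j)
  rw [meshSize, ← hj]
  exact sub_pos.2 (hx.lt_succ j j.2)

theorem inverse_inequality (hab : a < b) (hx : IsSubdivision a b n x) {p : ℕ} (hp : 1 ≤ p)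
    {q : Fin n → ℝ[X]} (hq : ∀ j, (q j).natDegree ≤ p) :
    ∑ j : Fin n, ∫ t in x j..x (j + 1), (derivative (q j)).eval t ^ 2 ≤
      12 * (p : ℝ) ^ 4 / meshSize n x ^ 2 *
        ∑ j : Fin n, ∫ t in x j..x (j + 1), (q j).eval t ^ 2 := by
  rw [Finset.mul_sum]
  refine Finset.sum_le_sum fun j _ => ?_
  have hj := hx.lt_succ j j.2
  refine (integral_derivative_sq_le hp (hq j) hj).trans ?_
  have h0 := meshSize_pos hab hx
  have h1 := meshSize_le (x := x) j
  have hnn : 0 ≤ ∫ t in x j..x (j + 1), (q j).eval t ^ 2 :=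
    intervalIntegral.integral_nonneg hj.le fun t _ => sq_nonneg _
  gcongr

theorem sum_integral_sq_pos (hx : IsSubdivision a b n x) {q : Fin n → ℝ[X]} (hq : q ≠ 0) :
    0 < ∑ j : Fin n, ∫ t in x j..x (j + 1), (q j).eval t ^ 2 := by
  have hnn : ∀ j : Fin n, 0 ≤ ∫ t in x j..x (j + 1), (q j).eval t ^ 2 := fun j =>
    intervalIntegral.integral_nonneg (hx.lt_succ j j.2).le fun t _ => sq_nonneg _
  obtain ⟨j, hj⟩ := Function.ne_iff.1 hq
  refine Finset.sum_pos' (fun j _ => hnn j) ⟨j, Finset.mem_univ _, (hnn j).lt_of_ne fun h => hj ?_⟩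
  exact polynomial_eq_zero_of_integral_sq (hx.lt_succ j j.2) h.symm

open Matrix in
/-- Localization of the spectrum for a linearly independent family of piecewise polynomials, given
an upper bound of the mass form by the screened form. -/
theorem matSpectrum_transformedMass_subset [DecidableEq ι] (hab : a < b)
    (hx : IsSubdivision a b n x) {p : ℕ} (hp : 1 ≤ p) {ω hi : ℝ} {Y : ι → ℝ → ℝ}
    {F : ι → Fin n → ℝ[X]} (hY : IsPiecewise x Y F) (hF : LinearIndependent ℝ F)
    (hdeg : ∀ i j, (F i j).natDegree ≤ p)
    (hhi : ∀ v : ι → ℝ, v ⬝ᵥ (massMatrix a b Y *ᵥ v) ≤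
      hi * (v ⬝ᵥ (negLaplacian a b Y *ᵥ v) + ω ^ 2 / 2 * (v ⬝ᵥ (massMatrix a b Y *ᵥ v))))
    {L : Matrix ι ι ℝ} (hL : L.transpose * L = screenedMatrix a b ω Y) :
    IsUnit L ∧ matSpectrum (transformedMass a b Y L) ⊆
      ((↑) : ℝ → ℂ) '' Set.Icc (lowerBound p ω (meshSize n x)) hi := by
  have hA : ∀ v : ι → ℝ, v ⬝ᵥ ((L.transpose * L) *ᵥ v) =
      v ⬝ᵥ (negLaplacian a b Y *ᵥ v) + ω ^ 2 / 2 * (v ⬝ᵥ (massMatrix a b Y *ᵥ v)) := by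
    intro v
    rw [hL, screenedMatrix, Matrix.add_mulVec, Matrix.smul_mulVec, dotProduct_add, dotProduct_smul,
      smul_eq_mul]
  have hKnn : ∀ v : ι → ℝ, 0 ≤ v ⬝ᵥ (negLaplacian a b Y *ᵥ v) := by
    intro v
    rw [quadForm_negLaplacian hx hY]
    exact Finset.sum_nonneg fun j _ =>
      intervalIntegral.integral_nonneg (hx.lt_succ j j.2).le fun t _ => sq_nonneg _
  have hMpos : ∀ v : ι → ℝ, v ≠ 0 → 0 < v ⬝ᵥ (massMatrix a b Y *ᵥ v) := by
    intro v hv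
    rw [quadForm_mass hx hY]
    exact sum_integral_sq_pos hx fun h0 => hv (funext (Fintype.linearIndependent_iff.1 hF v h0))
  refine matSpectrum_congr_subset (M := massMatrix a b Y) ?_ (fun v hv => ?_) (fun v => ?_)
    fun v => ?_
  · ext i k
    simp only [massMatrix, Matrix.transpose_apply, Matrix.of_apply, mul_comm]
  · rw [hA]
    have h1 := hMpos v hv
    have h2 := hKnn v
    have h3 := hhi v
    -- If the screened form vanished at v, the upper bound `hhi` would force the mass form to be
    -- nonpositive. This also covers ω = 0.
    refine (add_nonneg h2 (by positivity)).lt_of_ne fun h0 => ?_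
    rw [← h0, mul_zero] at h3
    linarith
  · rw [hA]
    have hinv : v ⬝ᵥ (negLaplacian a b Y *ᵥ v) ≤ 12 * (p : ℝ) ^ 4 / meshSize n x ^ 2 *
        (v ⬝ᵥ (massMatrix a b Y *ᵥ v)) := by
      rw [quadForm_negLaplacian hx hY, quadForm_mass hx hY]
      refine inverse_inequality hab hx hp fun j => ?_
      rw [Finset.sum_apply]
      refine natDegree_sum_le_of_forall_le _ _ fun i _ => ?_
      exact (natDegree_smul_le _ _).trans (hdeg i j)
    have hh := meshSize_pos hab hx
    have hp' : (0 : ℝ) < p := by exact_mod_cast hp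
    set k := v ⬝ᵥ (negLaplacian a b Y *ᵥ v)
    set m := v ⬝ᵥ (massMatrix a b Y *ᵥ v)
    set h := meshSize n x
    have hden : 0 < 24 * (p : ℝ) ^ 4 + ω ^ 2 * h ^ 2 := by positivity
    rw [lowerBound]
    -- The prefactor is the reciprocal of 12p⁴/h² + ω²/2.
    calc 2 * h ^ 2 / (24 * (p : ℝ) ^ 4 + ω ^ 2 * h ^ 2) * (k + ω ^ 2 / 2 * m)
        ≤ 2 * h ^ 2 / (24 * (p : ℝ) ^ 4 + ω ^ 2 * h ^ 2) *
          (12 * (p : ℝ) ^ 4 / h ^ 2 * m + ω ^ 2 / 2 * m) := by gcongr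
      _ = m := by field_simp; ring
  · rw [hA]
    exact hhi v

end PiecewisePolynomial

/-! ### Degree and independence of the integrated Legendre functions -/

theorem ultraspherical_natDegree_le_and_coeff_pos (k : ℕ) :
    (ultraspherical (3 / 2) k).natDegree ≤ k ∧ 0 < (ultraspherical (3 / 2) k).coeff k := by
  induction k using Nat.strong_induction_on with
  | _ k ih =>
    match k with
    | 0 => simp [ultraspherical]
    | 1 =>
      rw [ultraspherical]
      exact ⟨(natDegree_C_mul_le _ _).trans natDegree_X_le, by simp⟩
    | k + 2 =>
      obtain ⟨h1, h1'⟩ := ih (k + 1) (by omega)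
      obtain ⟨h0, -⟩ := ih k (by omega)
      rw [ultraspherical]
      constructor
      · refine (natDegree_C_mul_le _ _).trans ((natDegree_sub_le _ _).trans (max_le ?_ ?_))
        · refine natDegree_mul_le.trans ?_
          have := (natDegree_C_mul_le (2 * ((k : ℝ) + 1 + 3 / 2)) X).trans natDegree_X_le
          omega
        · exact (natDegree_C_mul_le _ _).trans (by omega)
      · rw [coeff_C_mul, coeff_sub, mul_assoc, coeff_C_mul, coeff_X_mul, coeff_C_mul,
          coeff_eq_zero_of_natDegree_lt (show natDegree _ < k + 2 by omega)]
        rw [mul_zero, sub_zero]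
        positivity

theorem ultraspherical_degree (k : ℕ) : (ultraspherical (3 / 2) k).degree = k := by
  obtain ⟨h1, h2⟩ := ultraspherical_natDegree_le_and_coeff_pos k
  exact degree_eq_of_le_of_coeff_ne_zero (natDegree_le_iff_degree_le.1 h1) h2.ne'

/-- The integrated Legendre functions as polynomials. -/
noncomputable def WPoly (k : ℕ) : ℝ[X] :=
  (1 / (((k : ℝ) + 1) * ((k : ℝ) + 2))) • ((1 - X ^ 2) * ultraspherical (3 / 2) k)

theorem eval_WPoly (k : ℕ) (t : ℝ) : (WPoly k).eval t = W k t := by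
  simp only [WPoly, W, eval_smul, smul_eq_mul, eval_mul, eval_sub, eval_one, eval_pow, eval_X]
  ring

theorem natDegree_WPoly_le (k : ℕ) : (WPoly k).natDegree ≤ k + 2 := by
  refine (natDegree_smul_le _ _).trans (natDegree_mul_le.trans ?_)
  have h1 : (1 - X ^ 2 : ℝ[X]).natDegree ≤ 2 := by compute_degree
  have h2 := (ultraspherical_natDegree_le_and_coeff_pos k).1
  omega

theorem W_one (k : ℕ) : W k 1 = 0 := by simp [W]

theorem W_neg_one (k : ℕ) : W k (-1) = 0 := by simp [W]

/-- The ultraspherical polynomials have pairwise distinct degrees, and both multiplication by 1 - X²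
and nonzero rescaling preserve independence. -/
theorem linearIndependent_WPoly : LinearIndependent ℝ WPoly := by
  let S : Polynomial.Sequence ℝ := ⟨ultraspherical (3 / 2), ultraspherical_degree⟩
  have hS : LinearIndependent ℝ (ultraspherical (3 / 2)) := S.linearIndependent
  have hmul := hS.map' (LinearMap.mulLeft ℝ (1 - X ^ 2 : ℝ[X])) (LinearMap.ker_eq_bot.2
    fun f g h => mul_left_cancel₀ (a := (1 - X ^ 2 : ℝ[X])) (fun h0 => by
      have := congrArg (eval 0) h0
      simp at this) h)
  have hu : ∀ k : ℕ, (1 / (((k : ℝ) + 1) * ((k : ℝ) + 2))) ≠ 0 := fun k => by positivity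
  exact hmul.units_smul fun k => Units.mk0 _ (hu k)

/-! ### Hats and bubbles as piecewise polynomials -/

variable {a b : ℝ} {n p : ℕ} {x : ℕ → ℝ}

/-- The hat function `h_i` restricted to the cell `j`. -/
noncomputable def hatPoly (x : ℕ → ℝ) (i j : ℕ) : ℝ[X] :=
  if i = j + 1 then C (1 / (x (j + 1) - x j)) * (X - C (x j))
  else if i = j then C (1 / (x (j + 1) - x j)) * (C (x (j + 1)) - X)
  else 0

/-- The affine map from the cell `j` onto `[-1,1]`. -/
noncomputable def cellMap (x : ℕ → ℝ) (j : ℕ) : ℝ[X] :=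
  C (2 / (x (j + 1) - x j)) * X + C (-(x j + x (j + 1)) / (x (j + 1) - x j))

theorem eval_cellMap (x : ℕ → ℝ) (j : ℕ) (t : ℝ) :
    (cellMap x j).eval t = (2 * t - x j - x (j + 1)) / (x (j + 1) - x j) := by
  simp only [cellMap, eval_add, eval_mul, eval_C, eval_X]
  ring

/-- The basis function of index `i` restricted to the cells. -/
noncomputable def basisPoly (n p : ℕ) (x : ℕ → ℝ) :
    Fin (n + 1) ⊕ (Fin (p - 1) × Fin n) → Fin n → ℝ[X]
  | Sum.inl i, j => hatPoly x i j
  | Sum.inr (k, i), j => if i = j then (WPoly k).comp (cellMap x j) else 0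

theorem natDegree_basisPoly_le (hp : 1 ≤ p) (i : Fin (n + 1) ⊕ (Fin (p - 1) × Fin n))
    (j : Fin n) : (basisPoly n p x i j).natDegree ≤ p := by
  rcases i with i | ⟨k, i⟩
  · refine le_trans ?_ hp
    simp only [basisPoly, hatPoly]
    split_ifs <;> compute_degree
    exact Nat.zero_le 1
  · simp only [basisPoly]
    split_ifs
    · refine natDegree_comp_le.trans ?_
      have h1 := natDegree_WPoly_le k
      have h2 : (cellMap x j).natDegree ≤ 1 := natDegree_linear_le
      have h3 := k.2
      calc _ ≤ ((k : ℕ) + 2) * 1 := Nat.mul_le_mul h1 h2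
        _ ≤ p := by omega
    · simp

theorem IsSubdivision.lt (hx : IsSubdivision a b n x) {i j : ℕ} (hij : i < j) (hj : j ≤ n) :
    x i < x j :=
  (hx.lt_succ i (by omega)).trans_le (hx.mono hij hj)

/-- Closed cells overlap at nodes, where the branch of `hat` that applies may belong to the
neighbouring cell. The work is to check that both formulas agree there. -/
theorem hat_eq_eval (hx : IsSubdivision a b n x) {i j : ℕ} (hi : i ≤ n) (hj : j < n) {t : ℝ}
    (h1 : x j ≤ t) (h2 : t ≤ x (j + 1)) : hat n x i t = (hatPoly x i j).eval t := by
  have hδ : x (j + 1) - x j ≠ 0 := (sub_pos.2 (hx.lt_succ j hj)).ne'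
  rcases lt_trichotomy i j with hij | rfl | hij
  · have e : (hatPoly x i j).eval t = 0 := by
      rw [hatPoly, if_neg (by omega), if_neg (by omega), eval_zero]
    have hlt : x i < t := (hx.lt hij hj.le).trans_le h1
    rw [e, hat, if_neg (by intro h; linarith [h.2.2])]
    split_ifs with h
    · have : x (i + 1) ≤ x j := hx.mono hij hj.le
      rw [show t = x (i + 1) by linarith [h.2.2], sub_self, zero_div]
    · rfl
  · have e : (hatPoly x i i).eval t = (x (i + 1) - t) / (x (i + 1) - x i) := by
      rw [hatPoly, if_neg (by omega), if_pos rfl]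
      simp only [eval_mul, eval_C, eval_sub, eval_X]
      ring
    rw [e, hat]
    split_ifs with h h'
    · have ht : t = x i := le_antisymm h.2.2 h1
      have hlt : x (i - 1) < x i := hx.lt (by omega) hi
      rw [ht, div_self hδ, div_self (sub_pos.2 hlt).ne']
    · rfl
    · exact absurd ⟨hj, h1, h2⟩ h'
  · rcases Nat.eq_or_lt_of_le (Nat.succ_le_of_lt hij) with rfl | hij'
    · have e : (hatPoly x (j + 1) j).eval t = (t - x j) / (x (j + 1) - x j) := by
        rw [hatPoly, if_pos rfl]
        simp only [eval_mul, eval_C, eval_sub, eval_X]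
        ring
      simp only [Nat.succ_eq_add_one]
      rw [e, hat, if_pos ⟨by omega, h1, h2⟩]
      rfl
    · have e : (hatPoly x i j).eval t = 0 := by
        rw [hatPoly, if_neg (by omega), if_neg (by omega), eval_zero]
      have hle : x (j + 1) ≤ x (i - 1) := hx.mono (by omega) (by omega)
      have hlt : x (j + 1) < x i := hx.lt hij' hi
      rw [e, hat, if_neg (c := i < n ∧ x i ≤ t ∧ t ≤ x (i + 1)) (by intro h; linarith [h.2.1])]
      split_ifs with h
      · rw [show t = x (i - 1) by linarith [h.2.1], sub_self, zero_div]
      · rfl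

theorem bubble_eq_eval (hx : IsSubdivision a b n x) {k i j : ℕ} (hi : i < n) (hj : j < n) {t : ℝ}
    (h1 : x j ≤ t) (h2 : t ≤ x (j + 1)) :
    bubble x k i t = if i = j then ((WPoly k).comp (cellMap x j)).eval t else 0 := by
  have hδ : x (i + 1) - x i ≠ 0 := (sub_pos.2 (hx.lt_succ i hi)).ne'
  rcases lt_trichotomy i j with hij | rfl | hij
  · have : x (i + 1) ≤ x j := hx.mono hij hj.le
    rw [if_neg hij.ne, bubble]
    split_ifs with h
    · rw [show t = x (i + 1) by linarith [h.2],
        show 2 * x (i + 1) - x i - x (i + 1) = x (i + 1) - x i by ring, div_self hδ, W_one]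
    · rfl
  · rw [if_pos rfl, bubble, if_pos ⟨h1, h2⟩, eval_comp, eval_cellMap, eval_WPoly]
  · have : x (j + 1) ≤ x i := hx.mono hij hi.le
    rw [if_neg hij.ne', bubble]
    split_ifs with h
    · rw [show t = x i by linarith [h.1],
        show 2 * x i - x i - x (i + 1) = -(x (i + 1) - x i) by ring, neg_div, div_self hδ, W_neg_one]
    · rfl

theorem isPiecewise_basisC (hx : IsSubdivision a b n x) :
    IsPiecewise x (basisC n p x) (basisPoly n p x) := by
  rintro (i | ⟨k, i⟩) j t h1 h2
  · exact hat_eq_eval hx (by omega) j.2 h1 h2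
  · simp only [basisC, basisPoly]
    rw [bubble_eq_eval hx i.2 j.2 h1 h2]
    simp only [Fin.ext_iff]
    split_ifs <;> simp

/-- Bubbles vanish at the nodes, so evaluating a vanishing combination at both ends of each cell
kills the hat coefficients. On each cell there remains a combination of the `WPoly k` composed with
a nonconstant affine map, which can be cancelled. -/
theorem linearIndependent_basisPoly (hn : 0 < n) (hx : IsSubdivision a b n x) :
    LinearIndependent ℝ (basisPoly n p x) := by
  rw [Fintype.linearIndependent_iff]
  intro v hv
  have hcell : ∀ j : Fin n, (∑ i : Fin (n + 1), v (Sum.inl i) • hatPoly x i j) +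
      ∑ k : Fin (p - 1), v (Sum.inr (k, j)) • (WPoly k).comp (cellMap x j) = 0 := by
    intro j
    have h := congrFun hv j
    rw [Fintype.sum_sum_type, Fintype.sum_prod_type] at h
    simpa [basisPoly] using h
  have hδ : ∀ j : Fin n, x (j + 1) - x j ≠ 0 := fun j => (sub_pos.2 (hx.lt_succ j j.2)).ne'
  have hhat : ∀ j : Fin n, ∑ i : Fin (n + 1), v (Sum.inl i) • hatPoly x i j =
      v (Sum.inl j.succ) • (C (1 / (x (j + 1) - x j)) * (X - C (x j))) +
        v (Sum.inl j.castSucc) • (C (1 / (x (j + 1) - x j)) * (C (x (j + 1)) - X)) := by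
    intro j
    rw [← Finset.add_sum_erase _ _ (Finset.mem_univ j.succ), ← Finset.add_sum_erase _ _
      (Finset.mem_erase.2 ⟨(Fin.castSucc_lt_succ (i := j)).ne, Finset.mem_univ j.castSucc⟩),
      Finset.sum_eq_zero, add_zero]
    · simp [hatPoly]
    · intro i hi
      simp only [Finset.mem_erase, Finset.mem_univ, and_true, ne_eq, Fin.ext_iff, Fin.val_succ,
        Fin.val_castSucc] at hi
      rw [hatPoly, if_neg hi.2, if_neg hi.1, smul_zero]
  have hleft : ∀ j : Fin n, v (Sum.inl j.castSucc) = 0 := by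
    intro j
    have h := congrArg (eval (x j)) (hcell j)
    have e : (cellMap x j).eval (x j) = -1 := by
      rw [eval_cellMap, div_eq_iff (hδ j)]
      ring
    rw [hhat] at h
    simpa [eval_finsetSum, e, eval_WPoly, W_neg_one, hδ j] using h
  have hright : ∀ j : Fin n, v (Sum.inl j.succ) = 0 := by
    intro j
    have h := congrArg (eval (x (j + 1))) (hcell j)
    have e : (cellMap x j).eval (x (j + 1)) = 1 := by
      rw [eval_cellMap, div_eq_iff (hδ j)]
      ring
    rw [hhat] at h
    simpa [eval_finsetSum, e, eval_WPoly, W_one, hδ j] using h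
  rintro (i | ⟨k, j⟩)
  · rcases Fin.eq_castSucc_or_eq_last i with ⟨j, rfl⟩ | rfl
    · exact hleft j
    -- The last hat is the left-end hat of no cell, so it needs the right end of the final cell.
    · have := hright ⟨n - 1, by omega⟩
      convert this using 3
      simp only [Fin.ext_iff, Fin.val_last, Fin.val_succ]
      omega
  · have h := hcell j
    rw [hhat, hleft, hright, zero_smul, zero_smul, add_zero, zero_add] at h
    have hcomp : (∑ k : Fin (p - 1), v (Sum.inr (k, j)) • WPoly k).comp (cellMap x j) = 0 := by
      simpa using h
    have hsum : ∑ k : Fin (p - 1), v (Sum.inr (k, j)) • WPoly k = 0 := by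
      rcases comp_eq_zero_iff.1 hcomp with h0 | ⟨-, h0⟩
      · exact h0
      · have h1 := congrArg natDegree h0
        rw [natDegree_C, cellMap, natDegree_linear (div_ne_zero two_ne_zero (hδ j))] at h1
        exact absurd h1 one_ne_zero
    exact Fintype.linearIndependent_iff.1
      (linearIndependent_WPoly.comp (fun k : Fin (p - 1) => (k : ℕ)) Fin.val_injective)
      (fun k => v (Sum.inr (k, j))) hsum k

/-! ### The Dirichlet basis as a subfamily vanishing at the endpoints -/

/-- The index of a Dirichlet basis function within the Neumann basis. -/
def dirichletIndex (n p : ℕ) :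
    Fin (n - 1) ⊕ (Fin (p - 1) × Fin n) → Fin (n + 1) ⊕ (Fin (p - 1) × Fin n) :=
  Sum.map (fun j => ⟨j + 1, by omega⟩) id

theorem dirichletIndex_injective (n p : ℕ) : Function.Injective (dirichletIndex n p) := by
  refine Sum.map_injective.2 ⟨fun i j h => ?_, Function.injective_id⟩
  simpa [Fin.ext_iff] using h

theorem basisQ_eq (n p : ℕ) (x : ℕ → ℝ) : basisQ n p x = basisC n p x ∘ dirichletIndex n p := by
  funext i
  rcases i with i | ⟨k, i⟩ <;> rfl

theorem basisQ_left (hx : IsSubdivision a b n x) (i) : basisQ n p x i a = 0 := by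
  rw [← hx.left]
  rcases i with i | ⟨k, i⟩
  · have hn : 0 < n := by have := i.pos; omega
    simp only [basisQ]
    rw [hat_eq_eval hx (by omega) hn le_rfl (hx.lt_succ 0 hn).le, hatPoly]
    split_ifs <;> simp_all
  · have hn : 0 < n := i.pos
    have e : (cellMap x 0).eval (x 0) = -1 := by
      rw [eval_cellMap, div_eq_iff (sub_pos.2 (hx.lt_succ 0 hn)).ne']
      ring
    simp only [basisQ]
    rw [bubble_eq_eval hx i.2 hn le_rfl (hx.lt_succ 0 hn).le, eval_comp, e, eval_WPoly, W_neg_one,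
      ite_self]

theorem basisQ_right (hx : IsSubdivision a b n x) (i) : basisQ n p x i b = 0 := by
  rw [← hx.right]
  obtain ⟨m, rfl⟩ : ∃ m, n = m + 1 := by
    rcases i with i | ⟨k, i⟩
    · exact ⟨n - 1, by have := i.pos; omega⟩
    · exact ⟨n - 1, by have := i.pos; omega⟩
  have hm := (hx.lt_succ m (by omega)).le
  rcases i with i | ⟨k, i⟩
  · have hi := i.2
    simp only [basisQ]
    rw [hat_eq_eval hx (by omega) (by omega) hm le_rfl, hatPoly, if_neg (by omega)]
    split_ifs <;> simp
  · have e : (cellMap x m).eval (x (m + 1)) = 1 := by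
      rw [eval_cellMap, div_eq_iff (sub_pos.2 (hx.lt_succ m (by omega))).ne']
      ring
    simp only [basisQ]
    rw [bubble_eq_eval hx i.2 (by omega) hm le_rfl, eval_comp, e, eval_WPoly, W_one, ite_self]

end HpFEM

/-! ### Both boundary conditions -/

theorem mainTheorem4 (a b ω : ℝ) (hab : a < b) (n p : ℕ) (hp : 1 ≤ p) (x : ℕ → ℝ)
    (hx : HpFEM.IsSubdivision a b n x) :
    (∀ L : Matrix (Fin (n - 1) ⊕ (Fin (p - 1) × Fin n)) (Fin (n - 1) ⊕ (Fin (p - 1) × Fin n)) ℝ,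
      L.transpose * L = HpFEM.screenedMatrix a b ω (HpFEM.basisQ n p x) →
        IsUnit L ∧
        HpFEM.matSpectrum (HpFEM.transformedMass a b (HpFEM.basisQ n p x) L) ⊆
          ((↑) : ℝ → ℂ) '' Set.Icc (HpFEM.lowerBound p ω (HpFEM.meshSize n x))
            (HpFEM.dirichletConst a b ω)) ∧
    (ω ≠ 0 →
      ∀ L : Matrix (Fin (n + 1) ⊕ (Fin (p - 1) × Fin n)) (Fin (n + 1) ⊕ (Fin (p - 1) × Fin n)) ℝ,
        L.transpose * L = HpFEM.screenedMatrix a b ω (HpFEM.basisC n p x) →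
          IsUnit L ∧
          HpFEM.matSpectrum (HpFEM.transformedMass a b (HpFEM.basisC n p x) L) ⊆
            ((↑) : ℝ → ℂ) '' Set.Icc (HpFEM.lowerBound p ω (HpFEM.meshSize n x))
              (HpFEM.neumannConst ω)) := by
  have hn := hx.pos hab
  have hC := HpFEM.isPiecewise_basisC (p := p) hx
  have hQ : HpFEM.IsPiecewise x (HpFEM.basisQ n p x)
      (HpFEM.basisPoly n p x ∘ HpFEM.dirichletIndex n p) := by
    rw [HpFEM.basisQ_eq]
    exact fun i => hC _
  have hI := HpFEM.linearIndependent_basisPoly (p := p) hn hx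
  -- Discarding the derivative term k already gives the constant 2/ω².
  have hmax : ∀ {k m : ℝ}, ω ≠ 0 → 0 ≤ k → 0 ≤ m →
      m ≤ max 1 (2 / ω ^ 2) * (k + ω ^ 2 / 2 * m) := by
    intro k m hω hk hm
    calc m = 2 / ω ^ 2 * (0 + ω ^ 2 / 2 * m) := by field_simp; ring
      _ ≤ _ := by gcongr; exact le_max_right _ _
  have hnn : ∀ {q : Fin n → Polynomial ℝ}, 0 ≤ ∑ j : Fin n, ∫ t in x j..x (j + 1),
      (q j).eval t ^ 2 := fun {q} => Finset.sum_nonneg fun j _ =>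
    intervalIntegral.integral_nonneg (hx.lt_succ j j.2).le fun t _ => sq_nonneg _
  constructor
  · intro L hL
    refine HpFEM.matSpectrum_transformedMass_subset hab hx hp hQ
      (hI.comp _ (HpFEM.dirichletIndex_injective n p))
      (fun i j => HpFEM.natDegree_basisPoly_le hp _ j) (fun v => ?_) hL
    rw [HpFEM.quadForm_mass hx hQ, HpFEM.quadForm_negLaplacian hx hQ]
    have hpoin := HpFEM.poincare_piecewise hab hx
      (u := fun t => ∑ i, v i * HpFEM.basisQ n p x i t)
      (q := ∑ i, v i • (HpFEM.basisPoly n p x ∘ HpFEM.dirichletIndex n p) i)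
      (fun j t h1 h2 => by
        simp only [Finset.sum_apply, Pi.smul_apply, Polynomial.eval_finsetSum,
          Polynomial.eval_smul, smul_eq_mul]
        exact Finset.sum_congr rfl fun i _ => by rw [hQ i j t h1 h2])
      (Finset.sum_eq_zero fun i _ => by rw [HpFEM.basisQ_left hx, mul_zero])
      (Finset.sum_eq_zero fun i _ => by rw [HpFEM.basisQ_right hx, mul_zero])
    have hm := hnn (q := ∑ i, v i • (HpFEM.basisPoly n p x ∘ HpFEM.dirichletIndex n p) i)
    have hk := hnn (q := fun j => Polynomial.derivative
      ((∑ i, v i • (HpFEM.basisPoly n p x ∘ HpFEM.dirichletIndex n p) i) j))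
    rw [HpFEM.dirichletConst]
    split_ifs with hω
    · simpa [hω] using hpoin
    -- The two bounds hold independently; the Poincaré bound only gains from the added mass term.
    · rw [min_mul_of_nonneg _ _ (by positivity)]
      refine le_min (hpoin.trans ?_) (hmax hω hk hm)
      gcongr
      exact le_add_of_nonneg_right (by positivity)
  · intro hω L hL
    refine HpFEM.matSpectrum_transformedMass_subset hab hx hp hC hI
      (fun i j => HpFEM.natDegree_basisPoly_le hp i j) (fun v => ?_) hL
    rw [HpFEM.quadForm_mass hx hC, HpFEM.quadForm_negLaplacian hx hC]
    exact hmax hω (hnn (q := fun j => Polynomial.derivative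
      ((∑ i, v i • HpFEM.basisPoly n p x i) j))) hnn
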